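/- Let $\ell(x)=x$ or $\ell(x)=1-x$, let $D_\ell=\{(x,y): 0\le x\le 1,\ 0\le y\le \ell(x)\}$, and let $K\in L^2(D_\ell)$ be a real kernel; if $\ell(x)=1-x$, assume in addition that $\iint_{D_\ell}\frac{|K(x,y)|^2}{1-y}\,dy\,dx<\infty$ (this holds, for instance, for every bounded measurable $K$). Consider the Volterra integral equation of the second kind $$u(x)-\int_0^{\ell(x)}K(x,y)\,u(y)\,dy=g(x),\qquad x\in(0,1),\qquad (*)$$ and assume that it is well posed, i.e. for every $g\in L^2(0,1)$ it has exactly one solution $u\in L^2(0,1)$. Let $p_n(x)=\sqrt{2(n+1)}\,P_n^{(1,0)}(2x-1)$, $n\ge 0$, be the Jacobi polynomials shifted to $[0,1]$ and normalised in $L^2((0,1),(1-x)\,dx)$. For $f\in L^2((0,1),(1-x)\,dx)$ let $\mathbf f=(f_n)_{n\ge0}\in\ell^2$, $f_n=\int_0^1(1-x)\,p_n(x)f(x)\,dx$, be its coefficient vector. Let $\mathrm V_K$ be the coefficient-space Volterra operator, i.e. the operator on $\ell^2$ with matrix entries $$(\mathrm V_K)_{ij}=\int_0^1(1-x)\,p_i(x)\int_0^{\ell(x)}K(x,y)\,p_j(y)\,dy\,dx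 ,$$ which is the matrix of $\mathrm S\,\mathrm R\,\mathrm L\,\mathrm Q_yK(\mathbb 1-\mathrm J_x,\mathrm J_y)\mathrm E_y$ for $\ell(x)=x$ and of $(\mathbb 1-\mathrm J)\,\mathrm Q_yK(\mathrm J_x,\mathrm J_y)\mathrm E_y$ for $\ell(x)=1-x$. Here, in terms of the represented functions, $\mathrm E_y$ sends $u$ to $(x,y)\mapsto u(y)$ on the simplex $\{0\le x,\ 0\le y\le1-x\}$, $K(\cdot,\cdot)$ evaluated at the Jacobi operators is multiplication by $K(1-x,y)$, respectively $K(x,y)$, $\mathrm Q_y$ sends $f$ to $\frac1{1-x}\int_0^{1-x}f(x,y)\,dy$, both $\mathrm L$ and $\mathbb 1-\mathrm J$ multiply by $1-x$, $\mathrm R$ is the reflection $x\mapsto1-x$, and $\mathrm S$ is a change of polynomial basis. Let $\mathcal P_n$ be the projection of $\ell^2$ onto the first $n$ coefficients. The sparse spectral method with truncation size $n$ solves the $n\times n$ system $\mathcal P_n(\mathbb 1-\mathrm V_K)\mathcal P_n\,\mathbf u_n=\mathcal P_n\mathbf g$ for $\mathbf u_n=\mathcal P_n\mathbf u_n$. Then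 $\mathrm V_K$ is a compact operator on $\ell^2$ and $\mathbb 1-\mathrm V_K$ is invertible. Moreover there are $N\in\mathbb N$ and $C\in\mathbb R$, depending only on $\ell$ and $K$, such that for all $n\ge N$ the $n\times n$ system is uniquely solvable, and for every $g\in L^2((0,1),(1-x)\,dx)$ (in particular for every $g\in L^2(0,1)$) equation $(*)$ has exactly one solution $u\in L^2((0,1),(1-x)\,dx)$, its coefficient vector satisfies $(\mathbb 1-\mathrm V_K)\mathbf u=\mathbf g$, and $$\|\mathbf u-\mathcal P_n\mathbf u\|_{\ell^2}\le\|\mathbf u-\mathbf u_n\|_{\ell^2}\le C\,\|\mathbf u-\mathcal P_n\mathbf u\|_{\ell^2}\quad(n\ge N),\qquad \|\mathbf u-\mathcal P_n\mathbf u\|_{\ell^2}\to0 .$$ In particular $\|\mathbf u-\mathbf u_n\|_{\ell^2}\to0$ as $n\to\infty$. -/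

import Mathlib

open MeasureTheory Filter Topology

noncomputable section

namespace VolterraSpectral

/-! ## Volterra equations of the second kind on `(0,1)` -/

/-- The two admissible upper limits of integration, `ℓ(x) = x` and `ℓ(x) = 1 - x`. -/
inductive Limit where
  | toX : Limit
  | toOneSubX : Limit

/-- The function `ℓ`. -/
def Limit.upper : Limit → ℝ → ℝ
  | .toX, x => x
  | .toOneSubX, x => 1 - x

/-- The triangle `{(x,y) : 0 ≤ x ≤ 1, 0 ≤ y ≤ ℓ(x)}` on which the kernel lives.
For `ℓ(x) = 1 - x` this is the unit simplex; for `ℓ(x) = x` it is its mirror image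
under `x ↦ 1 - x`. -/
def Limit.triangle (lim : Limit) : Set (ℝ × ℝ) :=
  {z | 0 ≤ z.1 ∧ z.1 ≤ 1 ∧ 0 ≤ z.2 ∧ z.2 ≤ lim.upper z.1}

/-- The Volterra integral operator `(𝒱_K u)(x) = ∫_0^{ℓ(x)} K(x,y) u(y) dy`. -/
def volterra (lim : Limit) (K : ℝ → ℝ → ℝ) (u : ℝ → ℝ) (x : ℝ) : ℝ :=
  ∫ y in (0 : ℝ)..lim.upper x, K x y * u y

/-- `u` solves `u(x) - ∫_0^{ℓ(x)} K(x,y) u(y) dy = g(x)` for almost every `x ∈ (0,1)`. -/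
def IsSolution (lim : Limit) (K : ℝ → ℝ → ℝ) (u g : ℝ → ℝ) : Prop :=
  ∀ᵐ x ∂(volume.restrict (Set.Ioo (0 : ℝ) 1)), u x - volterra lim K u x = g x

/-- Lebesgue measure on `(0,1)`. -/
def unitMeasure : Measure ℝ := volume.restrict (Set.Ioo (0 : ℝ) 1)

/-- The measure `(1 - x) dx` on `(0,1)`, the orthogonality measure of the shifted Jacobi
polynomials with parameters `(1,0)`. -/
def jacobiMeasure : Measure ℝ :=
  (volume.restrict (Set.Ioo (0 : ℝ) 1)).withDensity (fun x => ENNReal.ofReal (1 - x))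

/-- Square-integrable kernels. For `ℓ(x) = 1 - x` the kernel is also required to be square
integrable against `1 / (1 - y)`, which only constrains it at the corner `(0,1)` of the
simplex (every bounded measurable kernel satisfies this). -/
def AdmissibleKernel : Limit → (ℝ → ℝ → ℝ) → Prop
  | .toX, K =>
      MemLp (fun z : ℝ × ℝ => K z.1 z.2) 2 (volume.restrict Limit.toX.triangle)
  | .toOneSubX, K =>
      MemLp (fun z : ℝ × ℝ => K z.1 z.2) 2 (volume.restrict Limit.toOneSubX.triangle) ∧
      Integrable (fun z : ℝ × ℝ => K z.1 z.2 ^ 2 / (1 - z.2))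
        (volume.restrict Limit.toOneSubX.triangle)

/-- The equation is well posed in `L²(0,1)`: for every right-hand side `g ∈ L²(0,1)` there is
one and (up to null sets) only one solution `u ∈ L²(0,1)`. -/
def WellPosed (lim : Limit) (K : ℝ → ℝ → ℝ) : Prop :=
  ∀ g : ℝ → ℝ, MemLp g 2 unitMeasure →
    ∃ u : ℝ → ℝ, MemLp u 2 unitMeasure ∧ IsSolution lim K u g ∧
      ∀ v : ℝ → ℝ, MemLp v 2 unitMeasure → IsSolution lim K v g → v =ᵐ[unitMeasure] u

/-! ## Jacobi polynomials and coefficients -/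

/-- The Jacobi polynomial with natural parameters `(α,β)` shifted to `[0,1]`, i.e.
`P_n^{(α,β)}(2x - 1) = ∑_s C(n+α, n-s) C(n+β, s) (x-1)^s x^(n-s)`. -/
def shiftedJacobi (α β n : ℕ) (x : ℝ) : ℝ :=
  ∑ s ∈ Finset.range (n + 1),
    ((n + α).choose (n - s) : ℝ) * ((n + β).choose s : ℝ) * (x - 1) ^ s * x ^ (n - s)

/-- The shifted Jacobi polynomial with parameters `(1,0)`, normalised in `L²((1-x) dx)`:
the squared norm of `shiftedJacobi 1 0 n` there is `1 / (2 (n + 1))`. -/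
def jacobiBasis (n : ℕ) (x : ℝ) : ℝ :=
  Real.sqrt (2 * ((n : ℝ) + 1)) * shiftedJacobi 1 0 n x

/-- The `n`-th coefficient of `f` in the expansion `f = ∑ f_n p_n`, `p_n = jacobiBasis n`. -/
def jacobiCoeff (f : ℝ → ℝ) (n : ℕ) : ℝ :=
  ∫ x in (0 : ℝ)..1, (1 - x) * jacobiBasis n x * f x

/-- The coefficient space `ℓ²`. -/
abbrev CoeffSpace : Type := lp (fun _ : ℕ => ℝ) 2

/-! ## The method

The building blocks of the coefficient-space operator, described by their action on the
functions which the coefficient vectors represent. -/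

/-- `E_y`: extension of a function of one variable to the simplex. -/
def extendY (u : ℝ → ℝ) : ℝ → ℝ → ℝ := fun _ y => u y

/-- `K(J_x, J_y)`: multiplication by the kernel on the simplex. -/
def mulKernel (K : ℝ → ℝ → ℝ) (f : ℝ → ℝ → ℝ) : ℝ → ℝ → ℝ := fun x y => K x y * f x y

/-- `Q_y`: integration in `y` from `0` to `1 - x`, with the weight `1 - x` split off. -/
def integrateY (f : ℝ → ℝ → ℝ) : ℝ → ℝ := fun x => (1 - x)⁻¹ * ∫ y in (0 : ℝ)..(1 - x), f x y

/-- Multiplication by the weight `1 - x`: this is what both `1 - J` and the weighted lowering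
operator from the `(1,0)` to the `(0,0)` basis do to the represented function. -/
def mulWeight (f : ℝ → ℝ) : ℝ → ℝ := fun x => (1 - x) * f x

/-- `R`: reflection. -/
def reflect (f : ℝ → ℝ) : ℝ → ℝ := fun x => f (1 - x)

/-- The operator of the method on represented functions:
`S R L Q_y K(1 - J_x, J_y) E_y` for the limits `0` to `x`, and
`(1 - J) Q_y K(J_x, J_y) E_y` for the limits `0` to `1 - x`. The raising operator `S` is the
change of basis from `(0,0)` back to `(1,0)` and does not alter the represented function. -/
def methodOperator : Limit → (ℝ → ℝ → ℝ) → (ℝ → ℝ) → (ℝ → ℝ)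
  | .toX, K, u =>
      reflect (mulWeight (integrateY (mulKernel (fun x y => K (1 - x) y) (extendY u))))
  | .toOneSubX, K, u => mulWeight (integrateY (mulKernel K (extendY u)))

/-- The infinite matrix of the method's operator in the normalised `(1,0)` Jacobi basis. -/
def methodMatrix (lim : Limit) (K : ℝ → ℝ → ℝ) (i j : ℕ) : ℝ :=
  jacobiCoeff (methodOperator lim K (jacobiBasis j)) i

/-- The `n × n` linear system matrix of the method: the leading section of `1 - V_K`. -/
def sectionMatrix (lim : Limit) (K : ℝ → ℝ → ℝ) (n : ℕ) : Matrix (Fin n) (Fin n) ℝ :=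
  1 - Matrix.of (fun i j : Fin n => methodMatrix lim K i j)

/-- A vector of `n` coefficients, extended by zero to an element of `ℓ²`. -/
def embed {n : ℕ} (v : Fin n → ℝ) : CoeffSpace := ∑ i : Fin n, lp.single 2 (i : ℕ) (v i)

/-- The projection `𝒫_n`, keeping the first `n` coefficients. -/
def truncate (n : ℕ) (a : CoeffSpace) : CoeffSpace := embed (fun i : Fin n => a i)

/-- The output of the method with truncation size `n` for the coefficient vector `b` of the
right-hand side: the solution of the `n × n` system, extended by zero. -/
def methodSolution (lim : Limit) (K : ℝ → ℝ → ℝ) (n : ℕ) (b : CoeffSpace) : CoeffSpace :=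
  embed ((sectionMatrix lim K n)⁻¹.mulVec (fun i : Fin n => b i))

end VolterraSpectral

end

namespace VolterraSpectral

/-! ## Truncation in the coefficient space -/

/-! In L²((1-x) dx) the Volterra operator is Hilbert–Schmidt. Relative to (1-y) dy its kernel is
K(x,y)/(1-y) on the triangle, and its squared Hilbert–Schmidt norm is the integral of K² (1-x)/(1-y)
over the triangle. The ratio is at most 1 when y ≤ x; for the limit 1-x the extra integrability at
the corner takes over (`memLp_weightedKernel`). The normalised Jacobi polynomials form a Hilbert
basis of this space, so the coefficient operator V is unitarily equivalent to the integral operator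
and, by Bessel's inequality, has square-summable columns.

Square-summable columns give V P_n → V in operator norm, with P_n the truncation. Two things follow.
First, V is compact, so by the Fredholm alternative 1 - V is invertible once V f = f forces f = 0.
For the limit x this is a Gronwall argument; for the limit 1-x a fixed point in the weighted space
is shown to lie in L²(0,1), where well-posedness applies (`eq_zero_of_volterraL_eq_self`).

Second, 1 - V P_n is eventually invertible with bounded inverse, which makes the finite sections
uniformly stable (`exists_finite_section_stability`). Stability gives unique solvability and, by
comparing the computed vector with P_n of the exact one, quasi-optimality
(`exists_finite_section_quasi_optimal`). -/

lemma embed_apply {n : ℕ} (v : Fin n → ℝ) (i : ℕ) :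
    embed v i = if h : i < n then v ⟨i, h⟩ else 0 := by
  simp only [embed, lp.coeFn_sum, Finset.sum_apply, lp.single_apply]
  split_ifs with h
  · rw [Finset.sum_eq_single ⟨i, h⟩]
    · simp
    · intro j _ hj
      exact Pi.single_eq_of_ne (fun hij => hj (Fin.ext hij.symm)) _
    · simp
  · refine Finset.sum_eq_zero fun j _ => Pi.single_eq_of_ne (fun hij => h ?_) _
    exact hij ▸ j.2

lemma truncate_apply (n : ℕ) (a : CoeffSpace) (i : ℕ) :
    truncate n a i = if i < n then a i else 0 := by
  rw [truncate, embed_apply]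
  split_ifs <;> rfl

lemma truncate_embed {n : ℕ} (v : Fin n → ℝ) : truncate n (embed v) = embed v := by
  ext i
  rw [truncate_apply, embed_apply]
  split_ifs <;> rfl

lemma truncate_eq_sum (n : ℕ) (a : CoeffSpace) :
    truncate n a = ∑ i ∈ Finset.range n, lp.single 2 i (a i) := by
  rw [truncate, embed, Fin.sum_univ_eq_sum_range (fun i => lp.single 2 i (a i) : ℕ → CoeffSpace)]

lemma tendsto_truncate (a : CoeffSpace) :
    Tendsto (fun n => truncate n a) atTop (𝓝 a) := by
  simp_rw [truncate_eq_sum]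
  exact (lp.hasSum_single (by simp) a).tendsto_sum_nat

lemma coeff_norm_sq (a : CoeffSpace) : HasSum (fun i => a i ^ 2) (‖a‖ ^ 2) := by
  simpa using lp.hasSum_norm (p := 2) (by simp) a

lemma coeff_norm_le_of_abs_le {a b : CoeffSpace} (h : ∀ i, |a i| ≤ |b i|) : ‖a‖ ≤ ‖b‖ := by
  refine le_of_sq_le_sq ?_ (norm_nonneg _)
  exact hasSum_le (fun i => sq_le_sq.2 (h i)) (coeff_norm_sq a) (coeff_norm_sq b)

lemma norm_truncate_le (n : ℕ) (a : CoeffSpace) : ‖truncate n a‖ ≤ ‖a‖ := by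
  refine coeff_norm_le_of_abs_le fun i => ?_
  rw [truncate_apply]
  split_ifs <;> simp

/-- Truncation is the best approximation by vectors supported on the first `n` coefficients. -/
lemma norm_sub_truncate_le_norm_sub_embed {n : ℕ} (a : CoeffSpace) (v : Fin n → ℝ) :
    ‖a - truncate n a‖ ≤ ‖a - embed v‖ := by
  refine coeff_norm_le_of_abs_le fun i => ?_
  simp only [lp.coeFn_sub, Pi.sub_apply, truncate_apply, embed_apply]
  split_ifs <;> simp

/-- Truncation as a continuous linear map. -/
noncomputable def truncateL (n : ℕ) : CoeffSpace →L[ℝ] CoeffSpace :=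
  LinearMap.mkContinuous
    { toFun := truncate n
      map_add' := fun a b => by
        ext i
        simp only [lp.coeFn_add, Pi.add_apply, truncate_apply]
        split_ifs <;> simp
      map_smul' := fun c a => by
        ext i
        simp only [lp.coeFn_smul, Pi.smul_apply, truncate_apply, RingHom.id_apply]
        split_ifs <;> simp } 1
    (fun a => by simpa using norm_truncate_le n a)

@[simp] lemma truncateL_apply (n : ℕ) (a : CoeffSpace) : truncateL n a = truncate n a := rfl

/-- The first `n` coefficients. -/
noncomputable def leadingCoeffs (n : ℕ) : CoeffSpace →L[ℝ] (Fin n → ℝ) :=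
  LinearMap.mkContinuous
    { toFun := fun (a : CoeffSpace) (i : Fin n) => a i
      map_add' := fun _ _ => rfl
      map_smul' := fun _ _ => rfl } 1 (fun a => by
        rw [one_mul]
        exact (pi_norm_le_iff_of_nonneg (norm_nonneg _)).2
          fun i => lp.norm_apply_le_norm (by simp) a i)

lemma isCompactOperator_truncateL (n : ℕ) : IsCompactOperator (truncateL n) := by
  let G : (Fin n → ℝ) →L[ℝ] CoeffSpace :=
    ∑ i : Fin n, (lp.singleContinuousLinearMap ℝ (fun _ : ℕ => ℝ) 2 (i : ℕ)).comp
      (ContinuousLinearMap.proj i)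
  have hG : IsCompactOperator G := isCompactOperator_of_locallyCompactSpace_rng G
  have hc : (truncateL n : CoeffSpace → CoeffSpace) = G ∘ leadingCoeffs n := by
    ext1 a
    simp only [truncateL_apply, truncate, embed, Function.comp_apply, G,
      sum_apply, ContinuousLinearMap.comp_apply]
    rfl
  rw [hc]
  exact hG.comp_clm (leadingCoeffs n)

variable {E : Type*} [NormedAddCommGroup E] [NormedSpace ℝ E]

lemma map_truncate (T : CoeffSpace →L[ℝ] E) (n : ℕ) (a : CoeffSpace) :
    T (truncate n a) = ∑ i ∈ Finset.range n, a i • T (lp.single 2 i (1 : ℝ)) := by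
  rw [truncate_eq_sum, map_sum]
  refine Finset.sum_congr rfl fun i _ => ?_
  rw [← map_smul, ← lp.single_smul, smul_eq_mul, mul_one]

/-- A square-summable operator is well approximated by its restrictions to the leading
coefficients. -/
lemma norm_sub_comp_truncateL_le (T : CoeffSpace →L[ℝ] E)
    (hT : Summable fun j => ‖T (lp.single 2 j (1 : ℝ))‖ ^ 2) (n : ℕ) :
    ‖T - T.comp (truncateL n)‖ ≤ √(∑' j, ‖T (lp.single 2 (j + n) (1 : ℝ))‖ ^ 2) := by
  refine ContinuousLinearMap.opNorm_le_bound _ (Real.sqrt_nonneg _) fun a => ?_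
  -- It suffices to bound finite blocks of columns n ≤ i < m by Cauchy–Schwarz and let m → ∞.
  have hlim : Tendsto (fun m => ‖T (truncate m a) - T (truncate n a)‖) atTop
      (𝓝 ‖T a - T (truncate n a)‖) :=
    (((T.continuous.tendsto a).comp (tendsto_truncate a)).sub_const _).norm
  refine le_of_tendsto hlim ?_
  filter_upwards [eventually_ge_atTop n] with m hm
  rw [map_truncate, map_truncate, ← Finset.sum_Ico_eq_sub _ hm]
  calc ‖∑ i ∈ Finset.Ico n m, a i • T (lp.single 2 i (1 : ℝ))‖
      ≤ ∑ i ∈ Finset.Ico n m, ‖T (lp.single 2 i (1 : ℝ))‖ * |a i| := by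
        refine (norm_sum_le _ _).trans_eq (Finset.sum_congr rfl fun i _ => ?_)
        rw [norm_smul, Real.norm_eq_abs, mul_comm]
    _ ≤ √(∑ i ∈ Finset.Ico n m, ‖T (lp.single 2 i (1 : ℝ))‖ ^ 2) *
          √(∑ i ∈ Finset.Ico n m, |a i| ^ 2) := Real.sum_mul_le_sqrt_mul_sqrt _ _ _
    _ ≤ _ := by
        gcongr
        · rw [Finset.sum_Ico_eq_sum_range]
          simp_rw [add_comm n]
          exact ((summable_nat_add_iff n).2 hT).sum_le_tsum _ (fun _ _ => sq_nonneg _)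
        · refine Real.sqrt_le_iff.2 ⟨norm_nonneg _, ?_⟩
          simp_rw [sq_abs]
          exact sum_le_hasSum _ (fun _ _ => sq_nonneg _) (coeff_norm_sq a)

lemma tendsto_comp_truncateL (T : CoeffSpace →L[ℝ] E)
    (hT : Summable fun j => ‖T (lp.single 2 j (1 : ℝ))‖ ^ 2) :
    Tendsto (fun n => T.comp (truncateL n)) atTop (𝓝 T) := by
  rw [tendsto_iff_norm_sub_tendsto_zero]
  have h0 : Tendsto (fun n => √(∑' j, ‖T (lp.single 2 (j + n) (1 : ℝ))‖ ^ 2)) atTop (𝓝 0) := by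
    simpa using (tendsto_sum_nat_add fun j => ‖T (lp.single 2 j (1 : ℝ))‖ ^ 2).sqrt
  refine squeeze_zero (fun _ => norm_nonneg _) (fun n => ?_) h0
  rw [norm_sub_rev]
  exact norm_sub_comp_truncateL_le T hT n

/-- A norm limit of the finite-rank operators T P_n is compact. -/
lemma isCompactOperator_of_summable [CompleteSpace E] (T : CoeffSpace →L[ℝ] E)
    (hT : Summable fun j => ‖T (lp.single 2 j (1 : ℝ))‖ ^ 2) : IsCompactOperator T :=
  isCompactOperator_of_tendsto (tendsto_comp_truncateL T hT)
    (Eventually.of_forall fun n => (isCompactOperator_truncateL n).clm_comp T)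

/-! ## Convergence of the finite section method -/

/-- Uniform stability of the finite sections of a square-summable perturbation of the identity. -/
lemma exists_finite_section_stability (V : CoeffSpace →L[ℝ] CoeffSpace)
    (hV : Summable fun j => ‖V (lp.single 2 j (1 : ℝ))‖ ^ 2) (hu : IsUnit (1 - V)) :
    ∃ (C : ℝ) (N : ℕ), 0 ≤ C ∧ ∀ n, N ≤ n → ∀ w : CoeffSpace, truncate n w = w →
      ‖w‖ ≤ C * ‖w - truncate n (V w)‖ := by
  obtain ⟨U, hU⟩ := hu
  have hlim : Tendsto (fun n => 1 - V.comp (truncateL n)) atTop (𝓝 (U : CoeffSpace →L[ℝ] _)) := by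
    rw [hU]
    exact tendsto_const_nhds.sub (tendsto_comp_truncateL V hV)
  have hinv := ((NormedRing.inverse_continuousAt U).tendsto.comp hlim).norm
  have hunit : ∀ᶠ n in atTop, IsUnit (1 - V.comp (truncateL n)) :=
    hlim.eventually (Units.nhds U)
  have hbd := hinv.eventually_le_const (lt_add_one _)
  obtain ⟨N, hN⟩ := eventually_atTop.1 (hunit.and hbd)
  set M := ‖Ring.inverse (U : CoeffSpace →L[ℝ] CoeffSpace)‖ + 1
  -- M eventually bounds the inverse of 1 - V P_n, because inversion is continuous at the unit 1 -
  -- V.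
  refine ⟨1 + M * ‖V‖, N, by positivity, fun n hn w hw => ?_⟩
  obtain ⟨⟨R, hR⟩, hle⟩ := hN n hn
  simp only [Function.comp_apply, ← hR, Ring.inverse_unit] at hle
  set r := w - truncate n (V w) with hr
  -- Applying V to r = w - P_n V w gives (1 - V P_n) V w = V r. So V w is controlled by r, and then
  -- so is w = r + P_n V w.
  have h1 : (R : CoeffSpace →L[ℝ] CoeffSpace) (V w) = V r := by
    rw [hR, hr, map_sub]
    rfl
  have h2 : V w = (↑R⁻¹ : CoeffSpace →L[ℝ] CoeffSpace) (V r) := by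
    rw [← h1, ← mul_apply_eq_comp, Units.inv_mul]
    rfl
  have h3 : w = r + truncate n (V w) := by rw [hr]; abel
  calc ‖w‖ ≤ ‖r‖ + ‖truncate n (V w)‖ := by
        conv_lhs => rw [h3]
        exact norm_add_le _ _
    _ ≤ ‖r‖ + ‖V w‖ := by gcongr; exact norm_truncate_le _ _
    _ ≤ ‖r‖ + M * (‖V‖ * ‖r‖) := by
        gcongr
        rw [h2]
        exact (ContinuousLinearMap.le_opNorm _ _).trans
          (mul_le_mul hle (V.le_opNorm r) (norm_nonneg _) (by positivity))
    _ = _ := by ring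

/-- Turns the n × n system into the equation w - P_n V w = P_n b in ℓ², to which the stability
estimate applies. -/
lemma embed_section_mulVec {lim : Limit} {K : ℝ → ℝ → ℝ} {V : CoeffSpace →L[ℝ] CoeffSpace}
    (hV : ∀ i j : ℕ, V (lp.single 2 j (1 : ℝ)) i = methodMatrix lim K i j) (n : ℕ)
    (v : Fin n → ℝ) :
    embed ((sectionMatrix lim K n).mulVec v) = embed v - truncate n (V (embed v)) := by
  ext i
  rw [lp.coeFn_sub, Pi.sub_apply, truncate_apply, embed_apply, embed_apply]
  split_ifs with h
  · have hs : embed v = ∑ j : Fin n, v j • (lp.single 2 (j : ℕ) (1 : ℝ) : CoeffSpace) := by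
      rw [embed]
      refine Finset.sum_congr rfl fun j _ => ?_
      rw [← lp.single_smul, smul_eq_mul, mul_one]
    rw [sectionMatrix, Matrix.sub_mulVec, Matrix.one_mulVec, Pi.sub_apply, hs, map_sum,
      lp.coeFn_sum, Finset.sum_apply]
    congr 1
    simp only [Matrix.mulVec, dotProduct, Matrix.of_apply, map_smul, lp.coeFn_smul,
      Pi.smul_apply, hV, smul_eq_mul]
    exact Finset.sum_congr rfl fun j _ => mul_comm _ _
  · simp

lemma embed_injective {n : ℕ} : Function.Injective (embed : (Fin n → ℝ) → CoeffSpace) := by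
  intro v w h
  ext i
  have := congrArg (fun a : CoeffSpace => a (i : ℕ)) h
  simpa [embed_apply] using this

/-- Unique solvability and quasi-optimality of the finite section method. -/
theorem exists_finite_section_quasi_optimal {lim : Limit} {K : ℝ → ℝ → ℝ}
    {V : CoeffSpace →L[ℝ] CoeffSpace}
    (hmat : ∀ i j : ℕ, V (lp.single 2 j (1 : ℝ)) i = methodMatrix lim K i j)
    (hV : Summable fun j => ‖V (lp.single 2 j (1 : ℝ))‖ ^ 2) (hu : IsUnit (1 - V)) :
    ∃ (C : ℝ) (N : ℕ), (∀ n, N ≤ n → IsUnit (sectionMatrix lim K n)) ∧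
      ∀ a b : CoeffSpace, a - V a = b → ∀ n, N ≤ n →
        ‖a - methodSolution lim K n b‖ ≤ C * ‖a - truncate n a‖ := by
  obtain ⟨C, N, hC, h⟩ := exists_finite_section_stability V hV hu
  have hunit : ∀ n, N ≤ n → IsUnit (sectionMatrix lim K n) := by
    intro n hn
    rw [← Matrix.mulVec_injective_iff_isUnit]
    -- For a square matrix a trivial kernel is enough, and stability with zero residual gives it.
    refine (injective_iff_map_eq_zero (Matrix.mulVecLin (sectionMatrix lim K n))).2 fun v hv => ?_
    have hv' : (sectionMatrix lim K n).mulVec v = 0 := hv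
    have h1 := h n hn (embed v) (truncate_embed v)
    rw [← embed_section_mulVec hmat, hv'] at h1
    have h0 : (embed (0 : Fin n → ℝ)) = 0 := by simp [embed]
    rw [h0, norm_zero, mul_zero, norm_le_zero_iff, ← h0] at h1
    exact embed_injective h1
  refine ⟨1 + C * ‖V‖, N, hunit, fun a b hab n hn => ?_⟩
  set x := methodSolution lim K n b with hx
  have hxt : truncate n x = x := truncate_embed _
  have hsol : x - truncate n (V x) = truncate n b := by
    rw [hx, methodSolution, ← embed_section_mulVec hmat, Matrix.mulVec_mulVec,
      Matrix.mul_nonsing_inv _ ((Matrix.isUnit_iff_isUnit_det _).1 (hunit n hn)),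
      Matrix.one_mulVec]
    rfl
  have hidem : truncate n (truncate n a) = truncate n a := truncate_embed _
  have hsub : ∀ c d, truncate n (c - d) = truncate n c - truncate n d :=
    fun c d => map_sub (truncateL n) c d
  have hdiff := h n hn (truncate n a - x) (by rw [hsub, hidem, hxt])
  -- The residual of P_n a in the section equation involves only the tail a - P_n a, since P_n a -
  -- P_n V a = P_n b.
  have heq : truncate n a - x - truncate n (V (truncate n a - x)) =
      truncate n (V (a - truncate n a)) := by
    rw [map_sub, map_sub, hsub, hsub]
    have : truncate n a - truncate n (V a) = truncate n b := by rw [← hsub, hab]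
    rw [← hsol] at this
    rw [sub_eq_iff_eq_add.1 this]
    abel
  rw [heq] at hdiff
  calc ‖a - x‖ = ‖(a - truncate n a) + (truncate n a - x)‖ := by congr 1; abel
    _ ≤ ‖a - truncate n a‖ + ‖truncate n a - x‖ := norm_add_le _ _
    _ ≤ ‖a - truncate n a‖ + C * (‖V‖ * ‖a - truncate n a‖) := by
        gcongr
        exact hdiff.trans (mul_le_mul_of_nonneg_left
          ((norm_truncate_le _ _).trans (V.le_opNorm _)) hC)
    _ = _ := by ring

/-! ## Hilbert–Schmidt integral operators -/

section HilbertSchmidt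

variable {α : Type*} [MeasurableSpace α] {μ : Measure α}

lemma integral_mul_eq_inner {h : α → ℝ} (hh : MemLp h 2 μ) (f : Lp ℝ 2 μ) :
    ∫ y, h y * f y ∂μ = inner ℝ (hh.toLp h) f := by
  rw [L2.inner_def]
  refine integral_congr_ae ?_
  filter_upwards [hh.coeFn_toLp] with y hy
  simp [hy, mul_comm]

lemma norm_toLp_sq {h : α → ℝ} (hh : MemLp h 2 μ) : ‖hh.toLp h‖ ^ 2 = ∫ y, h y ^ 2 ∂μ := by
  rw [← real_inner_self_eq_norm_sq, ← integral_mul_eq_inner]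
  refine integral_congr_ae ?_
  filter_upwards [hh.coeFn_toLp] with y hy
  rw [hy, sq]

/-- Cauchy–Schwarz for a kernel section. -/
lemma sq_integral_mul_le {h : α → ℝ} (hh : MemLp h 2 μ) (f : Lp ℝ 2 μ) :
    (∫ y, h y * f y ∂μ) ^ 2 ≤ (∫ y, h y ^ 2 ∂μ) * ‖f‖ ^ 2 := by
  rw [integral_mul_eq_inner hh, ← norm_toLp_sq hh, ← mul_pow, sq_le_sq, abs_mul,
    abs_norm, abs_norm]
  exact abs_real_inner_le_norm _ _

variable {β : Type*} [MeasurableSpace β] {ν : Measure β} [SFinite μ] [SFinite ν]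

lemma ae_memLp_kernel {k : β → α → ℝ}
    (hk : MemLp (fun z : β × α => k z.1 z.2) 2 (ν.prod μ)) : ∀ᵐ x ∂ν, MemLp (k x) 2 μ := by
  filter_upwards [hk.1.prodMk_left, hk.integrable_sq.prod_right_ae] with x h1 h2
  exact (memLp_two_iff_integrable_sq h1).2 h2

lemma memLp_integral_kernel {k : β → α → ℝ}
    (hk : MemLp (fun z : β × α => k z.1 z.2) 2 (ν.prod μ))
    (f : Lp ℝ 2 μ) : MemLp (fun x => ∫ y, k x y * f y ∂μ) 2 ν := by
  have hm : AEStronglyMeasurable (fun x => ∫ y, k x y * f y ∂μ) ν :=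
    (hk.1.mul (Lp.memLp f).1.comp_snd).integral_prod_right'
  refine (memLp_two_iff_integrable_sq hm).2 ?_
  refine (hk.integrable_sq.integral_prod_left.mul_const (‖f‖ ^ 2)).mono' (hm.pow 2) ?_
  filter_upwards [ae_memLp_kernel hk] with x hx
  rw [Real.norm_eq_abs, abs_of_nonneg (sq_nonneg _)]
  exact sq_integral_mul_le hx f

variable {k : α → α → ℝ}

/-- The Hilbert–Schmidt operator with a given square-integrable kernel. -/
noncomputable def hilbertSchmidt (k : α → α → ℝ)
    (hk : MemLp (fun z : α × α => k z.1 z.2) 2 (μ.prod μ)) : Lp ℝ 2 μ →L[ℝ] Lp ℝ 2 μ :=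
  LinearMap.mkContinuous
    { toFun := fun f => (memLp_integral_kernel hk f).toLp _
      map_add' := fun f g => by
        rw [← MemLp.toLp_add]
        refine MemLp.toLp_congr _ _ ?_
        filter_upwards [ae_memLp_kernel hk] with x hx
        simp only [Pi.add_apply, integral_mul_eq_inner hx, inner_add_right]
      map_smul' := fun c f => by
        rw [RingHom.id_apply, ← MemLp.toLp_const_smul]
        refine MemLp.toLp_congr _ _ ?_
        filter_upwards [ae_memLp_kernel hk] with x hx
        simp only [Pi.smul_apply, integral_mul_eq_inner hx, inner_smul_right, smul_eq_mul] }
    √(∫ x, ∫ y, k x y ^ 2 ∂μ ∂μ) (fun f => by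
      refine le_of_sq_le_sq ?_ (by positivity)
      rw [mul_pow, Real.sq_sqrt (integral_nonneg fun x => integral_nonneg fun y => sq_nonneg _)]
      simp only [LinearMap.coe_mk, AddHom.coe_mk]
      rw [norm_toLp_sq, ← integral_mul_const]
      refine integral_mono_ae (memLp_integral_kernel hk f).integrable_sq
        (hk.integrable_sq.integral_prod_left.mul_const _) ?_
      filter_upwards [ae_memLp_kernel hk] with x hx
      exact sq_integral_mul_le hx f)

lemma hilbertSchmidt_ae (hk : MemLp (fun z : α × α => k z.1 z.2) 2 (μ.prod μ)) (f : Lp ℝ 2 μ) :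
    hilbertSchmidt k hk f =ᵐ[μ] fun x => ∫ y, k x y * f y ∂μ :=
  (memLp_integral_kernel hk f).coeFn_toLp

/-- Pointwise in x, the values at x of the images of the e_i are the inner products of k(x,·) with
e_i. Bessel's inequality bounds their sum of squares by the squared norm of k(x,·), and integrating
in x bounds every partial sum. -/
lemma summable_norm_hilbertSchmidt_sq (hk : MemLp (fun z : α × α => k z.1 z.2) 2 (μ.prod μ))
    {ι : Type*} {e : ι → Lp ℝ 2 μ} (he : Orthonormal ℝ e) :
    Summable fun i => ‖hilbertSchmidt k hk (e i)‖ ^ 2 := by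
  refine summable_of_sum_le (c := ∫ x, ∫ y, k x y ^ 2 ∂μ ∂μ) (fun _ => sq_nonneg _) fun s => ?_
  have h1 : ∀ i, ‖hilbertSchmidt k hk (e i)‖ ^ 2 = ∫ x, (∫ y, k x y * e i y ∂μ) ^ 2 ∂μ :=
    fun i => norm_toLp_sq (memLp_integral_kernel hk (e i))
  simp_rw [h1]
  rw [← integral_finsetSum _ fun i _ => (memLp_integral_kernel hk (e i)).integrable_sq]
  refine integral_mono_ae
    (integrable_finsetSum _ fun i _ => (memLp_integral_kernel hk (e i)).integrable_sq)
    hk.integrable_sq.integral_prod_left ?_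
  filter_upwards [ae_memLp_kernel hk] with x hx
  simp only [integral_mul_eq_inner hx, ← norm_toLp_sq hx]
  refine le_trans (le_of_eq ?_) (he.sum_inner_products_le (s := s) (hx.toLp (k x)))
  refine Finset.sum_congr rfl fun i _ => ?_
  rw [real_inner_comm, Real.norm_eq_abs, sq_abs]

end HilbertSchmidt

/-! ## The measure `(1 - x) dx` on `(0,1)` -/

lemma integral_jacobiMeasure (f : ℝ → ℝ) :
    ∫ x, f x ∂jacobiMeasure = ∫ x in (0 : ℝ)..1, (1 - x) * f x := by
  rw [jacobiMeasure, integral_withDensity_eq_integral_toReal_smul (by fun_prop)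
    (by simp), intervalIntegral.integral_of_le zero_le_one, integral_Ioc_eq_integral_Ioo]
  refine setIntegral_congr_fun measurableSet_Ioo fun x hx => ?_
  simp only [smul_eq_mul]
  rw [ENNReal.toReal_ofReal (by linarith [hx.2])]

lemma jacobiMeasure_absolutelyContinuous : jacobiMeasure ≪ unitMeasure :=
  withDensity_absolutelyContinuous _ _

lemma unitMeasure_absolutelyContinuous : unitMeasure ≪ jacobiMeasure := by
  refine withDensity_absolutelyContinuous' (by fun_prop) ?_
  filter_upwards [ae_restrict_mem measurableSet_Ioo] with x hx
  simpa using hx.2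

lemma ae_jacobiMeasure_iff {p : ℝ → Prop} :
    (∀ᵐ x ∂jacobiMeasure, p x) ↔ ∀ᵐ x ∂unitMeasure, p x :=
  ⟨fun h => unitMeasure_absolutelyContinuous.ae_le h,
    fun h => jacobiMeasure_absolutelyContinuous.ae_le h⟩

lemma ae_mem_Ioo_jacobiMeasure : ∀ᵐ x ∂jacobiMeasure, x ∈ Set.Ioo (0 : ℝ) 1 :=
  ae_jacobiMeasure_iff.2 (ae_restrict_mem measurableSet_Ioo)

instance : IsFiniteMeasure jacobiMeasure := by
  refine isFiniteMeasure_withDensity_ofReal (μ := volume.restrict (Set.Ioo (0 : ℝ) 1)) ?_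
  have : IntegrableOn (fun x : ℝ => 1 - x) (Set.Icc 0 1) :=
    Continuous.integrableOn_Icc (by fun_prop)
  exact (this.mono_set Set.Ioo_subset_Icc_self).2

lemma memLp_jacobiMeasure_of_continuous {f : ℝ → ℝ} (hf : Continuous f) :
    MemLp f 2 jacobiMeasure := by
  obtain ⟨C, hC⟩ := (isCompact_Icc (a := (0 : ℝ)) (b := 1)).exists_bound_of_continuousOn
    hf.continuousOn
  refine MemLp.of_bound hf.aestronglyMeasurable C ?_
  filter_upwards [ae_mem_Ioo_jacobiMeasure] with x hx
  exact hC x (Set.Ioo_subset_Icc_self hx)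

/-! ## Orthonormality of the shifted Jacobi polynomials -/

lemma integral_one_sub_pow_mul_pow (a b : ℕ) :
    ∫ x in (0 : ℝ)..1, (1 - x) ^ a * x ^ b =
      (a.factorial * b.factorial : ℝ) / (a + b + 1).factorial := by
  induction a generalizing b with
  | zero =>
    simp only [pow_zero, one_mul, integral_pow, one_pow, Nat.factorial_zero, Nat.cast_one,
      zero_add, Nat.factorial_succ]
    push_cast
    have : (b.factorial : ℝ) ≠ 0 := by positivity
    field_simp
    simp
  | succ a ih =>
    have h : ∀ x : ℝ, (1 - x) ^ (a + 1) * x ^ b =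
        (1 - x) ^ a * x ^ b - (1 - x) ^ a * x ^ (b + 1) := fun x => by ring
    simp_rw [h]
    rw [intervalIntegral.integral_sub, ih, ih]
    · rw [show a + (b + 1) + 1 = (a + b + 1) + 1 by ring,
        show a + 1 + b + 1 = (a + b + 1) + 1 by ring]
      simp only [Nat.factorial_succ (a + b + 1), Nat.factorial_succ a, Nat.factorial_succ b]
      have : ((a + b + 1).factorial : ℝ) ≠ 0 := by positivity
      push_cast
      field_simp
      ring
    · exact Continuous.intervalIntegrable (by fun_prop) _ _
    · exact Continuous.intervalIntegrable (by fun_prop) _ _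

open Polynomial in
/-- The shifted Jacobi polynomial with parameters `(1,0)` as an element of `ℝ[X]`. -/
noncomputable def jacobiPoly (n : ℕ) : ℝ[X] :=
  ∑ s ∈ Finset.range (n + 1),
    C (((n + 1).choose (n - s) : ℝ) * (n.choose s : ℝ)) * ((X - C 1) ^ s * X ^ (n - s))

lemma eval_jacobiPoly (n : ℕ) (x : ℝ) : (jacobiPoly n).eval x = shiftedJacobi 1 0 n x := by
  simp [jacobiPoly, shiftedJacobi, Polynomial.eval_finsetSum, mul_assoc]

lemma natDegree_jacobiPoly_term {n s : ℕ} (hs : s ≤ n) :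
    ((Polynomial.X - Polynomial.C (1 : ℝ)) ^ s * Polynomial.X ^ (n - s)).natDegree = n := by
  rw [((Polynomial.monic_X_sub_C (1 : ℝ)).pow s).natDegree_mul (Polynomial.monic_X_pow _),
    Polynomial.natDegree_pow, Polynomial.natDegree_X_sub_C, Polynomial.natDegree_X_pow]
  omega

lemma natDegree_jacobiPoly_le (n : ℕ) : (jacobiPoly n).natDegree ≤ n := by
  refine Polynomial.natDegree_sum_le_of_forall_le _ _ fun s hs => ?_
  exact (Polynomial.natDegree_C_mul_le _ _).trans
    (natDegree_jacobiPoly_term (by simpa [Nat.lt_succ_iff] using hs)).le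

/-- Each (X-1)^s X^(n-s) is monic of degree n, so the coefficient is a Vandermonde sum. -/
lemma coeff_jacobiPoly (n : ℕ) : (jacobiPoly n).coeff n = (2 * n + 1).choose n := by
  rw [jacobiPoly, Polynomial.finsetSum_coeff, show 2 * n + 1 = n + (n + 1) by ring,
    Nat.add_choose_eq, Finset.Nat.sum_antidiagonal_eq_sum_range_succ_mk, Nat.cast_sum]
  refine Finset.sum_congr rfl fun s hs => ?_
  have hs' : s ≤ n := by simpa [Nat.lt_succ_iff] using hs
  have hm : ((Polynomial.X - Polynomial.C (1 : ℝ)) ^ s * Polynomial.X ^ (n - s)).Monic :=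
    ((Polynomial.monic_X_sub_C (1 : ℝ)).pow s).mul (Polynomial.monic_X_pow _)
  have hc := hm.coeff_natDegree
  rw [natDegree_jacobiPoly_term hs'] at hc
  rw [Polynomial.coeff_C_mul, hc]
  push_cast
  ring

/-- The binomial formula for the n-th forward difference at 1, summed in reverse order. -/
lemma alternating_sum_choose_mul_eval (n : ℕ) (P : Polynomial ℝ) :
    ∑ s ∈ Finset.range (n + 1), (-1 : ℝ) ^ s * n.choose s * P.eval ((n - s : ℕ) + 1 : ℝ) =
      (fwdDiff 1)^[n] P.eval 1 := by
  rw [fwdDiff_iter_eq_sum_shift, ← Finset.sum_range_reflect]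
  refine Finset.sum_congr rfl fun s hs => ?_
  have hs' : s ≤ n := by simpa [Nat.lt_succ_iff] using hs
  rw [show n + 1 - 1 - s = n - s by omega, Nat.choose_symm hs', Nat.sub_sub_self hs']
  simp [zsmul_eq_mul, add_comm]

/-- The moments of a shifted Jacobi polynomial against `(1 - x) dx`. -/
lemma integral_jacobi_mul_pow (n m : ℕ) :
    ∫ x in (0 : ℝ)..1, (1 - x) * (shiftedJacobi 1 0 n x * x ^ m) =
      (n + 1).factorial / (n + m + 2).factorial *
        (fwdDiff 1)^[n] (ascPochhammer ℝ m).eval 1 := by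
  have h : ∀ x : ℝ, (1 - x) * (shiftedJacobi 1 0 n x * x ^ m) =
      ∑ s ∈ Finset.range (n + 1), ((n + 1).choose (n - s) * n.choose s * (-1) ^ s : ℝ) *
        ((1 - x) ^ (s + 1) * x ^ (n - s + m)) := by
    intro x
    rw [shiftedJacobi, Finset.sum_mul, Finset.mul_sum]
    refine Finset.sum_congr rfl fun s _ => ?_
    rw [show (x - 1) ^ s = (-1) ^ s * (1 - x) ^ s by rw [← mul_pow]; ring]
    simp only [add_zero]
    ring
  simp_rw [h]
  rw [intervalIntegral.integral_finsetSum
    fun s _ => Continuous.intervalIntegrable (by fun_prop) _ _,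
    ← alternating_sum_choose_mul_eval, Finset.mul_sum]
  refine Finset.sum_congr rfl fun s hs => ?_
  have hs' : s ≤ n := by simpa [Nat.lt_succ_iff] using hs
  rw [intervalIntegral.integral_const_mul, integral_one_sub_pow_mul_pow,
    show s + 1 + (n - s + m) + 1 = n + m + 2 by omega]
  -- The Beta integral contributes (s+1)! (n-s+m)!. The first factor cancels against the binomial
  -- coefficient, leaving (n-s+m)!/(n-s)!, which is a polynomial of degree m in n-s: the rising
  -- factorial.
  have h1 : (n + 1).choose (n - s) * (n - s).factorial * (s + 1).factorial =
      (n + 1).factorial := by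
    have := Nat.choose_mul_factorial_mul_factorial (show n - s ≤ n + 1 by omega)
    rwa [show n + 1 - (n - s) = s + 1 by omega] at this
  have h2 : (n - s).factorial * (n - s + 1).ascFactorial m = (n - s + m).factorial :=
    Nat.factorial_mul_ascFactorial _ _
  have h3 : (ascPochhammer ℝ m).eval ((n - s : ℕ) + 1 : ℝ) = (n - s + 1).ascFactorial m := by
    rw [← ascPochhammer_nat_eq_ascFactorial, ascPochhammer_eval_cast, Nat.cast_add_one]
  rw [h3, ← h1, ← h2]
  push_cast
  ring

/-- The n-th difference of a polynomial of degree m < n vanishes. -/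
lemma integral_jacobi_mul_pow_of_lt {n m : ℕ} (h : m < n) :
    ∫ x in (0 : ℝ)..1, (1 - x) * (shiftedJacobi 1 0 n x * x ^ m) = 0 := by
  rw [integral_jacobi_mul_pow, Polynomial.fwdDiff_iter_eq_zero_of_degree_lt]
  · simp
  · rwa [ascPochhammer_natDegree]

lemma integral_jacobi_mul_pow_self (n : ℕ) :
    ∫ x in (0 : ℝ)..1, (1 - x) * (shiftedJacobi 1 0 n x * x ^ n) =
      ((n + 1).factorial * n.factorial : ℝ) / (2 * n + 2).factorial := by
  have h := Polynomial.fwdDiff_iter_degree_eq_factorial (ascPochhammer ℝ n)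
  rw [ascPochhammer_natDegree, (monic_ascPochhammer ℝ n).leadingCoeff] at h
  rw [integral_jacobi_mul_pow, h, two_mul]
  simp
  ring

lemma continuous_shiftedJacobi (n : ℕ) : Continuous (shiftedJacobi 1 0 n) := by
  unfold shiftedJacobi
  fun_prop

/-- Only the degree-n term of q survives, the lower moments being zero. This yields both
orthogonality and normalisation. -/
lemma integral_jacobi_mul_eval (n : ℕ) {q : Polynomial ℝ} (hq : q.natDegree ≤ n) :
    ∫ x in (0 : ℝ)..1, (1 - x) * (shiftedJacobi 1 0 n x * q.eval x) =
      q.coeff n * (((n + 1).factorial * n.factorial : ℝ) / (2 * n + 2).factorial) := by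
  have hc := continuous_shiftedJacobi n
  have h : ∀ x : ℝ, (1 - x) * (shiftedJacobi 1 0 n x * q.eval x) =
      ∑ i ∈ Finset.range (n + 1),
        q.coeff i * ((1 - x) * (shiftedJacobi 1 0 n x * x ^ i)) := by
    intro x
    rw [Polynomial.eval_eq_sum_range' (Nat.lt_succ_of_le hq), Finset.mul_sum, Finset.mul_sum]
    exact Finset.sum_congr rfl fun i _ => by ring
  simp_rw [h]
  rw [intervalIntegral.integral_finsetSum
    fun s _ => Continuous.intervalIntegrable (by fun_prop) _ _, Finset.sum_range_succ,
    Finset.sum_eq_zero, zero_add, intervalIntegral.integral_const_mul,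
    integral_jacobi_mul_pow_self]
  intro i hi
  rw [intervalIntegral.integral_const_mul,
    integral_jacobi_mul_pow_of_lt (Finset.mem_range.1 hi), mul_zero]

lemma integral_jacobi_mul_jacobi_self (n : ℕ) :
    ∫ x in (0 : ℝ)..1, (1 - x) * (shiftedJacobi 1 0 n x * shiftedJacobi 1 0 n x) =
      1 / (2 * (n + 1)) := by
  have h := integral_jacobi_mul_eval n (natDegree_jacobiPoly_le n)
  simp_rw [eval_jacobiPoly] at h
  rw [h, coeff_jacobiPoly]
  have h1 := Nat.choose_mul_factorial_mul_factorial (show n ≤ 2 * n + 1 by omega)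
  rw [show 2 * n + 1 - n = n + 1 by omega] at h1
  rw [show 2 * n + 2 = (2 * n + 1) + 1 by ring, Nat.factorial_succ (2 * n + 1), ← h1]
  have hch : ((2 * n + 1).choose n : ℝ) ≠ 0 := by
    exact_mod_cast (Nat.choose_pos (by omega)).ne'
  have hf1 : (n.factorial : ℝ) ≠ 0 := by positivity
  have hf2 : ((n + 1).factorial : ℝ) ≠ 0 := by positivity
  push_cast
  field_simp
  ring

lemma integral_jacobi_mul_jacobi_of_lt {n m : ℕ} (hmn : m < n) :
    ∫ x in (0 : ℝ)..1, (1 - x) * (shiftedJacobi 1 0 n x * shiftedJacobi 1 0 m x) = 0 := by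
  have hd := (natDegree_jacobiPoly_le m).trans_lt hmn
  have h := integral_jacobi_mul_eval n hd.le
  simp_rw [eval_jacobiPoly] at h
  rw [h, Polynomial.coeff_eq_zero_of_natDegree_lt hd, zero_mul]

lemma integral_jacobiBasis_mul (i j : ℕ) :
    ∫ x in (0 : ℝ)..1, (1 - x) * (jacobiBasis i x * jacobiBasis j x) = if i = j then 1 else 0 := by
  have h : ∀ x : ℝ, (1 - x) * (jacobiBasis i x * jacobiBasis j x) =
      (√(2 * ((i : ℝ) + 1)) * √(2 * ((j : ℝ) + 1))) *
        ((1 - x) * (shiftedJacobi 1 0 i x * shiftedJacobi 1 0 j x)) := by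
    intro x
    simp only [jacobiBasis]
    ring
  simp_rw [h]
  rw [intervalIntegral.integral_const_mul]
  rcases lt_trichotomy i j with hij | rfl | hij
  · rw [if_neg hij.ne]
    simp_rw [mul_comm (shiftedJacobi 1 0 i _)]
    rw [integral_jacobi_mul_jacobi_of_lt hij, mul_zero]
  · rw [if_pos rfl, integral_jacobi_mul_jacobi_self, Real.mul_self_sqrt (by positivity)]
    field_simp
  · rw [if_neg hij.ne', integral_jacobi_mul_jacobi_of_lt hij, mul_zero]

lemma continuous_jacobiBasis (n : ℕ) : Continuous (jacobiBasis n) :=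
  continuous_const.mul (continuous_shiftedJacobi n)

/-- The polynomial `p_n` as an element of the weighted `L²` space. -/
noncomputable def jacobiLp (n : ℕ) : Lp ℝ 2 jacobiMeasure :=
  (memLp_jacobiMeasure_of_continuous (continuous_jacobiBasis n)).toLp _

lemma jacobiLp_ae (n : ℕ) : jacobiLp n =ᵐ[jacobiMeasure] jacobiBasis n := MemLp.coeFn_toLp _

lemma inner_jacobiLp (n : ℕ) (f : Lp ℝ 2 jacobiMeasure) :
    inner ℝ (jacobiLp n) f = jacobiCoeff f n := by
  rw [jacobiLp, ← integral_mul_eq_inner, integral_jacobiMeasure, jacobiCoeff]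
  simp_rw [mul_assoc]

lemma jacobiCoeff_congr {f g : ℝ → ℝ} (h : f =ᵐ[jacobiMeasure] g) (n : ℕ) :
    jacobiCoeff f n = jacobiCoeff g n := by
  simp only [jacobiCoeff, mul_assoc]
  rw [← integral_jacobiMeasure (fun x => jacobiBasis n x * f x),
    ← integral_jacobiMeasure (fun x => jacobiBasis n x * g x)]
  refine integral_congr_ae ?_
  filter_upwards [h] with x hx
  rw [hx]

lemma orthonormal_jacobiLp : Orthonormal ℝ jacobiLp := by
  rw [orthonormal_iff_ite]
  intro i j
  rw [inner_jacobiLp, jacobiCoeff_congr (jacobiLp_ae j), jacobiCoeff, ← integral_jacobiBasis_mul]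
  simp_rw [mul_assoc]

/-! ## Completeness of the shifted Jacobi polynomials -/

/-- Strong induction: orthogonality to p_m leaves only the leading term, whose coefficient is
nonzero. -/
lemma integral_pow_mul_eq_zero {f : Lp ℝ 2 jacobiMeasure} (hf : ∀ n, inner ℝ (jacobiLp n) f = 0)
    (m : ℕ) : ∫ x, x ^ m * f x ∂jacobiMeasure = 0 := by
  induction m using Nat.strong_induction_on with
  | _ m ih =>
    have hint : ∀ (g : ℝ → ℝ), Continuous g → Integrable (fun x => g x * f x) jacobiMeasure :=
      fun g hg => (memLp_jacobiMeasure_of_continuous hg).integrable_mul (Lp.memLp f)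
    have h0 : ∫ x, shiftedJacobi 1 0 m x * f x ∂jacobiMeasure = 0 := by
      have h1 := hf m
      rw [jacobiLp, ← integral_mul_eq_inner] at h1
      simp only [jacobiBasis, mul_assoc] at h1
      rw [integral_const_mul] at h1
      exact (mul_eq_zero.1 h1).resolve_left (by positivity)
    have hexp : ∀ x : ℝ, shiftedJacobi 1 0 m x * f x =
        ∑ i ∈ Finset.range (m + 1), (jacobiPoly m).coeff i * (x ^ i * f x) := by
      intro x
      rw [← eval_jacobiPoly,
        Polynomial.eval_eq_sum_range' (Nat.lt_succ_of_le (natDegree_jacobiPoly_le m)),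
        Finset.sum_mul]
      exact Finset.sum_congr rfl fun i _ => by ring
    simp_rw [hexp] at h0
    rw [integral_finsetSum _ fun i _ => (hint _ (continuous_pow i)).const_mul _,
      Finset.sum_range_succ, Finset.sum_eq_zero, zero_add, integral_const_mul,
      coeff_jacobiPoly] at h0
    · exact (mul_eq_zero.1 h0).resolve_left
        (by exact_mod_cast (Nat.choose_pos (by omega)).ne')
    · intro i hi
      rw [integral_const_mul, ih i (Finset.mem_range.1 hi), mul_zero]

lemma integral_eval_mul_eq_zero {f : Lp ℝ 2 jacobiMeasure} (hf : ∀ n, inner ℝ (jacobiLp n) f = 0)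
    (q : Polynomial ℝ) : ∫ x, q.eval x * f x ∂jacobiMeasure = 0 := by
  have hexp : ∀ x : ℝ, q.eval x * f x =
      ∑ i ∈ Finset.range (q.natDegree + 1), q.coeff i * (x ^ i * f x) := by
    intro x
    rw [Polynomial.eval_eq_sum_range, Finset.sum_mul]
    exact Finset.sum_congr rfl fun i _ => by ring
  have hint : ∀ i : ℕ, Integrable (fun x => x ^ i * f x) jacobiMeasure := fun i =>
    (memLp_jacobiMeasure_of_continuous (continuous_pow i)).integrable_mul (Lp.memLp f)
  simp_rw [hexp]
  rw [integral_finsetSum _ fun i _ => (hint i).const_mul _]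
  exact Finset.sum_eq_zero fun i _ => by
    rw [integral_const_mul, integral_pow_mul_eq_zero hf, mul_zero]

/-- Since f annihilates all polynomials, Weierstrass approximation on [0,1] makes it annihilate
every smooth test function. -/
lemma eq_zero_of_inner_jacobiLp {f : Lp ℝ 2 jacobiMeasure}
    (hf : ∀ n, inner ℝ (jacobiLp n) f = 0) : f = 0 := by
  have hfi : Integrable f jacobiMeasure := (Lp.memLp f).integrable (by norm_num)
  refine (Lp.eq_zero_iff_ae_eq_zero).2
    (ae_eq_zero_of_integral_contDiff_smul_eq_zero hfi.locallyIntegrable fun g hg _ => ?_)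
  have hgc := hg.continuous
  have hgi : Integrable (fun x => g x * f x) jacobiMeasure :=
    (memLp_jacobiMeasure_of_continuous hgc).integrable_mul (Lp.memLp f)
  simp only [smul_eq_mul]
  by_contra hne
  set I := ∫ x, |f x| ∂jacobiMeasure
  have hI : 0 ≤ I := integral_nonneg fun _ => abs_nonneg _
  have hJ : 0 < |∫ x, g x * f x ∂jacobiMeasure| := abs_pos.2 hne
  set J := |∫ x, g x * f x ∂jacobiMeasure|
  -- With this tolerance the error is at most J · I/(I+1) < J, a contradiction; the +1 covers I = 0.
  obtain ⟨p, hp⟩ := exists_polynomial_near_of_continuousOn 0 1 g hgc.continuousOn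
    (J / (I + 1)) (by positivity)
  have hpi : Integrable (fun x => p.eval x * f x) jacobiMeasure :=
    (memLp_jacobiMeasure_of_continuous p.continuous).integrable_mul (Lp.memLp f)
  have hle : J ≤ J / (I + 1) * I := by
    calc J = |∫ x, (g x * f x - p.eval x * f x) ∂jacobiMeasure| := by
          rw [integral_sub hgi hpi, integral_eval_mul_eq_zero hf, sub_zero]
      _ ≤ ∫ x, |g x * f x - p.eval x * f x| ∂jacobiMeasure := abs_integral_le_integral_abs
      _ ≤ ∫ x, J / (I + 1) * |f x| ∂jacobiMeasure := by
          refine integral_mono_ae (hgi.sub hpi).abs (hfi.abs.const_mul _) ?_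
          filter_upwards [ae_mem_Ioo_jacobiMeasure] with x hx
          rw [← sub_mul, abs_mul, abs_sub_comm]
          gcongr
          exact (hp x (Set.Ioo_subset_Icc_self hx)).le
      _ = _ := integral_const_mul _ _
  rw [div_mul_eq_mul_div, le_div_iff₀ (by positivity)] at hle
  nlinarith

/-- The shifted Jacobi polynomials form a Hilbert basis of the weighted `L²` space. -/
noncomputable def jacobiHilbertBasis : HilbertBasis ℕ ℝ (Lp ℝ 2 jacobiMeasure) :=
  HilbertBasis.mkOfOrthogonalEqBot orthonormal_jacobiLp <| by
    rw [Submodule.eq_bot_iff]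
    intro f hf
    exact eq_zero_of_inner_jacobiLp fun n =>
      (Submodule.mem_orthogonal _ _).1 hf _ (Submodule.subset_span ⟨n, rfl⟩)

lemma coe_jacobiHilbertBasis : ⇑jacobiHilbertBasis = jacobiLp :=
  HilbertBasis.coe_mkOfOrthogonalEqBot _ _

lemma jacobiHilbertBasis_repr_apply (f : Lp ℝ 2 jacobiMeasure) (n : ℕ) :
    jacobiHilbertBasis.repr f n = jacobiCoeff f n := by
  rw [HilbertBasis.repr_apply_apply, coe_jacobiHilbertBasis, inner_jacobiLp]

/-! ## The Volterra operator on the weighted space -/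

/-- The kernel of the Volterra operator with respect to the measure `(1 - y) dy`. -/
noncomputable def weightedKernel (lim : Limit) (K : ℝ → ℝ → ℝ) (x y : ℝ) : ℝ :=
  lim.triangle.indicator (fun z => K z.1 z.2 / (1 - z.2)) (x, y)

lemma Limit.continuous_upper (lim : Limit) : Continuous lim.upper := by
  cases lim
  · exact continuous_id
  · exact continuous_const.sub continuous_id

lemma Limit.measurableSet_triangle (lim : Limit) : MeasurableSet lim.triangle := by
  have h := lim.continuous_upper
  refine IsClosed.measurableSet ?_
  refine (isClosed_le continuous_const continuous_fst).inter
    ((isClosed_le continuous_fst continuous_const).inter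
      ((isClosed_le continuous_const continuous_snd).inter
        (isClosed_le continuous_snd (h.comp continuous_fst))))

lemma Limit.upper_mem_Ioo (lim : Limit) {x : ℝ} (hx : x ∈ Set.Ioo (0 : ℝ) 1) :
    lim.upper x ∈ Set.Ioo (0 : ℝ) 1 := by
  cases lim
  · exact hx
  · exact ⟨sub_pos.2 hx.2, sub_lt_self 1 hx.1⟩

lemma AdmissibleKernel.memLp {lim : Limit} {K : ℝ → ℝ → ℝ} (hK : AdmissibleKernel lim K) :
    MemLp (fun z : ℝ × ℝ => K z.1 z.2) 2 (volume.restrict lim.triangle) := by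
  cases lim
  · exact hK
  · exact hK.1

lemma unitMeasure_prod :
    unitMeasure.prod unitMeasure =
      (volume : Measure (ℝ × ℝ)).restrict (Set.Ioo (0 : ℝ) 1 ×ˢ Set.Ioo (0 : ℝ) 1) := by
  rw [unitMeasure, Measure.prod_restrict, Measure.volume_eq_prod]

instance : SFinite unitMeasure := by unfold unitMeasure; infer_instance

lemma aestronglyMeasurable_weightedKernel {lim : Limit} {K : ℝ → ℝ → ℝ}
    (hK : AdmissibleKernel lim K) :
    AEStronglyMeasurable (fun z : ℝ × ℝ => weightedKernel lim K z.1 z.2)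
      (unitMeasure.prod unitMeasure) := by
  rw [unitMeasure_prod]
  refine AEStronglyMeasurable.restrict ?_
  refine (aestronglyMeasurable_indicator_iff lim.measurableSet_triangle).2 ?_
  have h : AEStronglyMeasurable (fun z : ℝ × ℝ => (1 - z.2)⁻¹) (volume.restrict lim.triangle) :=
    Measurable.aestronglyMeasurable (by fun_prop)
  simp only [div_eq_mul_inv]
  exact hK.memLp.1.mul h

/-- The weighted kernel is square integrable against `(1 - x) dx (1 - y) dy`. -/
lemma memLp_weightedKernel {lim : Limit} {K : ℝ → ℝ → ℝ} (hK : AdmissibleKernel lim K) :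
    MemLp (fun z : ℝ × ℝ => weightedKernel lim K z.1 z.2) 2
      (jacobiMeasure.prod jacobiMeasure) := by
  have hm := aestronglyMeasurable_weightedKernel hK
  have hac : jacobiMeasure.prod jacobiMeasure ≪ unitMeasure.prod unitMeasure :=
    jacobiMeasure_absolutelyContinuous.prod jacobiMeasure_absolutelyContinuous
  rw [memLp_two_iff_integrable_sq (hm.mono_ac hac)]
  -- The two densities turn the integrand into K² (1-x)/(1-y) on the triangle. It is majorised by K²
  -- when y ≤ x, and by the integrable K²/(1-y) for the limit 1-x.
  have hmaj : ∃ B : ℝ × ℝ → ℝ, Integrable B (unitMeasure.prod unitMeasure) ∧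
      ∀ z ∈ Set.Ioo (0 : ℝ) 1 ×ˢ Set.Ioo (0 : ℝ) 1,
        (1 - z.1) * (1 - z.2) * weightedKernel lim K z.1 z.2 ^ 2 ≤ B z := by
    have key : ∀ B : ℝ × ℝ → ℝ, Integrable B (volume.restrict lim.triangle) →
        Integrable (lim.triangle.indicator B) (unitMeasure.prod unitMeasure) := fun B hB => by
      rw [unitMeasure_prod]
      exact ((integrable_indicator_iff lim.measurableSet_triangle).2 hB).restrict
    cases lim
    · refine ⟨_, key _ hK.memLp.integrable_sq, fun z hz => ?_⟩
      by_cases hzt : z ∈ Limit.toX.triangle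
      · have hxy : z.2 ≤ z.1 := hzt.2.2.2
        have h1 : 0 < 1 - z.2 := sub_pos.2 hz.2.2
        rw [weightedKernel, Set.indicator_of_mem hzt, Set.indicator_of_mem hzt]
        calc (1 - z.1) * (1 - z.2) * (K z.1 z.2 / (1 - z.2)) ^ 2
            = (1 - z.1) / (1 - z.2) * K z.1 z.2 ^ 2 := by field_simp
          _ ≤ 1 * K z.1 z.2 ^ 2 := by
              gcongr
              rw [div_le_one h1]
              linarith
          _ = _ := one_mul _
      · simp [weightedKernel, Set.indicator_of_notMem hzt]
    · refine ⟨_, key _ hK.2, fun z hz => ?_⟩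
      by_cases hzt : z ∈ Limit.toOneSubX.triangle
      · have h1 : 0 < 1 - z.2 := sub_pos.2 hz.2.2
        rw [weightedKernel, Set.indicator_of_mem hzt, Set.indicator_of_mem hzt]
        calc (1 - z.1) * (1 - z.2) * (K z.1 z.2 / (1 - z.2)) ^ 2
            = (1 - z.1) * (K z.1 z.2 ^ 2 / (1 - z.2)) := by field_simp
          _ ≤ 1 * (K z.1 z.2 ^ 2 / (1 - z.2)) := by
              gcongr
              linarith [hz.1.1]
          _ = _ := one_mul _
      · simp [weightedKernel, Set.indicator_of_notMem hzt]
  obtain ⟨B, hB, hle⟩ := hmaj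
  have hw : Measurable fun x : ℝ => ENNReal.ofReal (1 - x) := by fun_prop
  have hw2 : Measurable fun z : ℝ × ℝ => ENNReal.ofReal (1 - z.1) * ENNReal.ofReal (1 - z.2) := by
    fun_prop
  rw [jacobiMeasure, prod_withDensity hw hw, integrable_withDensity_iff_integrable_smul' hw2
      (Eventually.of_forall fun _ => ENNReal.mul_lt_top ENNReal.ofReal_lt_top
        ENNReal.ofReal_lt_top)]
  change Integrable _ (unitMeasure.prod unitMeasure)
  refine hB.mono' ?_ ?_
  · exact hw2.ennreal_toReal.aestronglyMeasurable.smul (hm.pow 2)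
  · rw [unitMeasure_prod]
    filter_upwards [ae_restrict_mem (measurableSet_Ioo.prod measurableSet_Ioo)] with z hz
    have h1 : 0 ≤ 1 - z.1 := (sub_pos.2 hz.1.2).le
    have h2 : 0 ≤ 1 - z.2 := (sub_pos.2 hz.2.2).le
    rw [smul_eq_mul, ENNReal.toReal_mul, ENNReal.toReal_ofReal h1, ENNReal.toReal_ofReal h2,
      Real.norm_eq_abs, abs_of_nonneg (by positivity)]
    exact hle z hz

/-- Dropping the weight in x leaves exactly the integrand K²/(1-y) of the admissibility condition.
Hence the operator maps the weighted space into L²(0,1), which is what uniqueness needs. -/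
lemma memLp_weightedKernel_toOneSubX {K : ℝ → ℝ → ℝ} (hK : AdmissibleKernel .toOneSubX K) :
    MemLp (fun z : ℝ × ℝ => weightedKernel .toOneSubX K z.1 z.2) 2
      (unitMeasure.prod jacobiMeasure) := by
  have hm := aestronglyMeasurable_weightedKernel hK
  have hac : unitMeasure.prod jacobiMeasure ≪ unitMeasure.prod unitMeasure :=
    Measure.AbsolutelyContinuous.rfl.prod jacobiMeasure_absolutelyContinuous
  rw [memLp_two_iff_integrable_sq (hm.mono_ac hac)]
  have hB : Integrable (Limit.toOneSubX.triangle.indicator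
      fun z : ℝ × ℝ => K z.1 z.2 ^ 2 / (1 - z.2)) (unitMeasure.prod unitMeasure) := by
    rw [unitMeasure_prod]
    exact ((integrable_indicator_iff (Limit.measurableSet_triangle _)).2 hK.2).restrict
  have hw : Measurable fun x : ℝ => ENNReal.ofReal (1 - x) := by fun_prop
  rw [jacobiMeasure, prod_withDensity_right hw,
    integrable_withDensity_iff_integrable_smul' (by fun_prop)
      (Eventually.of_forall fun _ => ENNReal.ofReal_lt_top)]
  change Integrable _ (unitMeasure.prod unitMeasure)
  refine hB.congr ?_
  rw [unitMeasure_prod]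
  filter_upwards [ae_restrict_mem (measurableSet_Ioo.prod measurableSet_Ioo)] with z hz
  have h2 : 0 < 1 - z.2 := sub_pos.2 hz.2.2
  rw [smul_eq_mul, ENNReal.toReal_ofReal h2.le]
  by_cases hzt : z ∈ Limit.toOneSubX.triangle
  · rw [weightedKernel, Set.indicator_of_mem hzt, Set.indicator_of_mem hzt]
    field_simp
  · simp [weightedKernel, Set.indicator_of_notMem hzt]

lemma integral_weightedKernel_mul (lim : Limit) (K : ℝ → ℝ → ℝ) (f : ℝ → ℝ) {x : ℝ}
    (hx : x ∈ Set.Ioo (0 : ℝ) 1) :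
    ∫ y, weightedKernel lim K x y * f y ∂jacobiMeasure = volterra lim K f x := by
  have hu := lim.upper_mem_Ioo hx
  rw [integral_jacobiMeasure, volterra, intervalIntegral.integral_of_le zero_le_one,
    intervalIntegral.integral_of_le hu.1.le, integral_Ioc_eq_integral_Ioo,
    ← integral_indicator measurableSet_Ioo, ← integral_indicator measurableSet_Ioc]
  congr 1
  ext y
  by_cases hy : y ∈ Set.Ioc 0 (lim.upper x)
  · have hy1 : y < 1 := hy.2.trans_lt hu.2
    have hmem : (x, y) ∈ lim.triangle := ⟨hx.1.le, hx.2.le, hy.1.le, hy.2⟩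
    have hne : 1 - y ≠ 0 := (sub_pos.2 hy1).ne'
    rw [Set.indicator_of_mem hy, Set.indicator_of_mem (show y ∈ Set.Ioo (0 : ℝ) 1 from ⟨hy.1, hy1⟩),
      weightedKernel, Set.indicator_of_mem hmem]
    field_simp
  · rw [Set.indicator_of_notMem hy]
    by_cases hy' : y ∈ Set.Ioo (0 : ℝ) 1
    · have hmem : (x, y) ∉ lim.triangle := fun h => hy ⟨hy'.1, h.2.2.2⟩
      rw [Set.indicator_of_mem hy', weightedKernel, Set.indicator_of_notMem hmem]
      simp
    · rw [Set.indicator_of_notMem hy']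

lemma volterra_congr (lim : Limit) (K : ℝ → ℝ → ℝ) {f g : ℝ → ℝ} (h : f =ᵐ[jacobiMeasure] g)
    {x : ℝ} (hx : x ∈ Set.Ioo (0 : ℝ) 1) : volterra lim K f x = volterra lim K g x := by
  rw [← integral_weightedKernel_mul lim K f hx, ← integral_weightedKernel_mul lim K g hx]
  refine integral_congr_ae ?_
  filter_upwards [h] with y hy
  rw [hy]

/-- The Volterra operator on `L²((1-x) dx)`. -/
noncomputable def volterraL {lim : Limit} {K : ℝ → ℝ → ℝ} (hK : AdmissibleKernel lim K) :
    Lp ℝ 2 jacobiMeasure →L[ℝ] Lp ℝ 2 jacobiMeasure :=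
  hilbertSchmidt (weightedKernel lim K) (memLp_weightedKernel hK)

lemma volterraL_ae {lim : Limit} {K : ℝ → ℝ → ℝ} (hK : AdmissibleKernel lim K)
    (f : Lp ℝ 2 jacobiMeasure) : volterraL hK f =ᵐ[jacobiMeasure] volterra lim K f := by
  filter_upwards [hilbertSchmidt_ae (memLp_weightedKernel hK) f, ae_mem_Ioo_jacobiMeasure]
    with x h hx
  rw [← integral_weightedKernel_mul lim K f hx, ← h]
  rfl

/-- The weight multiplied on cancels the one divided out by `integrateY`; for the limit x the
reflection turns that weight into x, which is nonzero on the open interval. -/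
lemma methodOperator_eq_volterra (lim : Limit) (K : ℝ → ℝ → ℝ) (u : ℝ → ℝ) {x : ℝ}
    (hx : x ∈ Set.Ioo (0 : ℝ) 1) : methodOperator lim K u x = volterra lim K u x := by
  have h1 : 1 - x ≠ 0 := (sub_pos.2 hx.2).ne'
  cases lim
  · simp only [methodOperator, reflect, mulWeight, integrateY, mulKernel, extendY, volterra,
      Limit.upper, sub_sub_cancel]
    rw [mul_inv_cancel_left₀ hx.1.ne']
  · simp only [methodOperator, mulWeight, integrateY, mulKernel, extendY, volterra, Limit.upper]
    rw [mul_inv_cancel_left₀ h1]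

/-- Lebesgue measure on (0,1) and (1-x) dx have the same null sets, so the pointwise equation is an
identity in the weighted space. -/
lemma isSolution_iff {lim : Limit} {K : ℝ → ℝ → ℝ} (hK : AdmissibleKernel lim K)
    {u g : ℝ → ℝ} (hu : MemLp u 2 jacobiMeasure) (hg : MemLp g 2 jacobiMeasure) :
    IsSolution lim K u g ↔ hu.toLp u - volterraL hK (hu.toLp u) = hg.toLp g := by
  have h : hu.toLp u - volterraL hK (hu.toLp u) =ᵐ[jacobiMeasure]
      fun x => u x - volterra lim K u x := by
    filter_upwards [Lp.coeFn_sub (hu.toLp u) (volterraL hK (hu.toLp u)), hu.coeFn_toLp,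
      volterraL_ae hK (hu.toLp u), ae_mem_Ioo_jacobiMeasure] with x h1 h2 h3 hx
    rw [h1, Pi.sub_apply, h2, h3, volterra_congr lim K hu.coeFn_toLp hx]
  rw [Lp.ext_iff]
  refine (ae_jacobiMeasure_iff.symm.trans ?_ :
    (∀ᵐ x ∂unitMeasure, u x - volterra lim K u x = g x) ↔ _)
  constructor
  · intro hs
    filter_upwards [h, hs, hg.coeFn_toLp] with x h1 h2 h3
    rw [h1, h2, h3]
  · intro hs
    filter_upwards [h, hs, hg.coeFn_toLp] with x h1 h2 h3
    rw [← h1, h2, h3]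

/-! ## Uniqueness in the weighted space -/

instance : NullSingletonClass jacobiMeasure :=
  ⟨fun x => withDensity_absolutelyContinuous _ _
    (Measure.absolutelyContinuous_of_le Measure.restrict_le_self (measure_singleton x))⟩

/-- A Gronwall inequality with a merely integrable coefficient. -/
lemma integral_eq_zero_of_le_mul_integral {μ : Measure ℝ} [NullSingletonClass μ] {F N : ℝ → ℝ}
    (hF : Integrable F μ) (hN : Integrable N μ) (hF0 : ∀ x, 0 ≤ F x) (hN0 : ∀ x, 0 ≤ N x)
    (hle : ∀ᵐ x ∂μ, x ∈ Set.Ioo (0 : ℝ) 1 → F x ≤ N x * ∫ y in (0 : ℝ)..x, F y ∂μ) :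
    ∫ y in (0 : ℝ)..1, F y ∂μ = 0 := by
  set Φ : ℝ → ℝ := fun t => ∫ y in (0 : ℝ)..t, F y ∂μ with hΦ
  have hFi : ∀ a b, IntervalIntegrable F μ a b := fun a b => hF.intervalIntegrable
  have hNi : ∀ a b, IntervalIntegrable N μ a b := fun a b => hN.intervalIntegrable
  have hΦc : Continuous Φ := intervalIntegral.continuous_primitive hFi 0
  have hMc : Continuous fun t => ∫ y in (0 : ℝ)..t, N y ∂μ :=
    intervalIntegral.continuous_primitive hNi 0
  have hmono : ∀ {s t : ℝ}, s ≤ t → Φ s ≤ Φ t := fun {s t} hst => by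
    rw [← sub_nonneg, hΦ]
    simp only
    rw [intervalIntegral.integral_interval_sub_left (hFi _ _) (hFi _ _)]
    exact intervalIntegral.integral_nonneg_of_forall hst hF0
  -- Continuation along [0,1]: the zero set of Φ is closed and contains 0, so it suffices to push
  -- past each of its points x < 1. For z close to x the integral of N over (x,z] is below 1, and
  -- Φ(z) ≤ (∫ N) Φ(z) forces Φ(z) = 0.
  have hsub : Set.Icc (0 : ℝ) 1 ⊆ {t | Φ t = 0} := by
    refine IsClosed.Icc_subset_of_forall_exists_gt
      ((isClosed_eq hΦc continuous_const).inter isClosed_Icc) (by simp [hΦ]) ?_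
    rintro x ⟨hx0, hx⟩ y hy
    have hx0' : Φ x = 0 := hx0
    have hev : ∀ᶠ z in 𝓝[>] x, ∫ s in x..z, N s ∂μ < 1 := by
      refine Filter.Eventually.filter_mono nhdsWithin_le_nhds ?_
      have hc : Continuous fun z => ∫ s in x..z, N s ∂μ :=
        intervalIntegral.continuous_primitive hNi x
      exact (hc.tendsto x).eventually_lt_const (by simp)
    have hlt : ∀ᶠ z in 𝓝[>] x, z ∈ Set.Ioo x (min y 1) :=
      Ioo_mem_nhdsGT (lt_min hy hx.2)
    obtain ⟨z, hz1, hz⟩ := (hev.and hlt).exists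
    refine ⟨z, ?_, hz.1, (hz.2.trans_le (min_le_left _ _)).le⟩
    have hzle : Φ z ≤ (∫ s in x..z, N s ∂μ) * Φ z := by
      calc Φ z = ∫ s in x..z, F s ∂μ := by
            rw [← intervalIntegral.integral_interval_sub_left (hFi 0 z) (hFi 0 x)]
            change Φ z = Φ z - Φ x
            rw [hx0', sub_zero]
        _ ≤ ∫ s in x..z, N s * Φ z ∂μ := by
            rw [intervalIntegral.integral_of_le hz.1.le, intervalIntegral.integral_of_le hz.1.le]
            refine integral_mono_ae hF.restrict (hN.mul_const _).restrict ?_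
            filter_upwards [ae_restrict_of_ae hle, ae_restrict_mem measurableSet_Ioc] with s hs hsz
            have hs1 : s < 1 := hsz.2.trans_lt (hz.2.trans_le (min_le_right _ _))
            exact (hs ⟨hx.1.trans_lt hsz.1, hs1⟩).trans
              (mul_le_mul_of_nonneg_left (hmono hsz.2) (hN0 s))
        _ = _ := intervalIntegral.integral_mul_const _ _
    have hz0 : 0 ≤ Φ z := by
      rw [← hx0']
      exact hmono hz.1.le
    change Φ z = 0
    nlinarith
  exact hsub ⟨zero_le_one, le_rfl⟩

/-- Cauchy–Schwarz gives f(x)² ≤ N(x) ∫_0^x f², where N(x) is the squared norm of k(x,·) and is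
integrable; Gronwall then kills f. -/
lemma eq_zero_of_volterraL_toX {K : ℝ → ℝ → ℝ} (hK : AdmissibleKernel .toX K)
    {f : Lp ℝ 2 jacobiMeasure} (hf : volterraL hK f = f) : f = 0 := by
  have hk := memLp_weightedKernel hK
  set k := weightedKernel .toX K with hkdef
  have hz := integral_eq_zero_of_le_mul_integral (μ := jacobiMeasure) (F := fun x => f x ^ 2)
    (N := fun x => ∫ y, k x y ^ 2 ∂jacobiMeasure) (Lp.memLp f).integrable_sq
    hk.integrable_sq.integral_prod_left (fun x => sq_nonneg _)
    (fun x => integral_nonneg fun y => sq_nonneg _) (by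
      have h := hilbertSchmidt_ae hk f
      change volterraL hK f =ᵐ[jacobiMeasure] _ at h
      rw [hf] at h
      filter_upwards [h, ae_memLp_kernel hk] with x hx hkx hx01
      -- Since k(x,·) vanishes beyond x, f may be cut off there, so Cauchy–Schwarz sees only its
      -- norm on (0,x].
      have hfi : MemLp ((Set.Ioc 0 x).indicator f) 2 jacobiMeasure :=
        (Lp.memLp f).indicator measurableSet_Ioc
      have hcut : ∫ y, k x y * f y ∂jacobiMeasure =
          ∫ y, k x y * hfi.toLp _ y ∂jacobiMeasure := by
        refine integral_congr_ae ?_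
        filter_upwards [hfi.coeFn_toLp, ae_mem_Ioo_jacobiMeasure] with y hy hy01
        rw [hy]
        by_cases hyx : y ≤ x
        · rw [Set.indicator_of_mem (show y ∈ Set.Ioc 0 x from ⟨hy01.1, hyx⟩)]
        · have hmem : (x, y) ∉ Limit.toX.triangle := fun hm => hyx hm.2.2.2
          simp [hkdef, weightedKernel, Set.indicator_of_notMem hmem]
      have hnorm : ‖hfi.toLp _‖ ^ 2 = ∫ y in (0 : ℝ)..x, f y ^ 2 ∂jacobiMeasure := by
        rw [norm_toLp_sq, intervalIntegral.integral_of_le hx01.1.le,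
          ← integral_indicator measurableSet_Ioc]
        refine integral_congr_ae (Eventually.of_forall fun y => ?_)
        by_cases hy : y ∈ Set.Ioc 0 x
        · simp [Set.indicator_of_mem hy]
        · simp [Set.indicator_of_notMem hy]
      rw [← hnorm, hx, hcut]
      exact sq_integral_mul_le hkx _)
  have hn : ‖f‖ ^ 2 = 0 := by
    rw [← Lp.toLp_coeFn f (Lp.memLp f), norm_toLp_sq, ← hz,
      intervalIntegral.integral_of_le zero_le_one]
    refine (setIntegral_eq_integral_of_ae_compl_eq_zero ?_).symm
    filter_upwards [ae_mem_Ioo_jacobiMeasure] with x hx hx'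
    exact absurd (Set.Ioo_subset_Ioc_self hx) hx'
  exact norm_eq_zero.1 (pow_eq_zero_iff two_ne_zero |>.1 hn)

/-- A fixed point equals its own image, so it lies in L²(0,1); there well-posedness with g = 0
identifies it with the zero solution. -/
lemma eq_zero_of_volterraL_toOneSubX {K : ℝ → ℝ → ℝ} (hK : AdmissibleKernel .toOneSubX K)
    (hwp : WellPosed .toOneSubX K) {f : Lp ℝ 2 jacobiMeasure} (hf : volterraL hK f = f) :
    f = 0 := by
  have hT := unitMeasure_absolutelyContinuous.ae_le (volterraL_ae hK f)
  rw [hf] at hT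
  have hIoo : ∀ᵐ x ∂unitMeasure, x ∈ Set.Ioo (0 : ℝ) 1 := ae_restrict_mem measurableSet_Ioo
  have hfu : MemLp f 2 unitMeasure := by
    refine (memLp_congr_ae ?_).1 (memLp_integral_kernel (memLp_weightedKernel_toOneSubX hK) f)
    filter_upwards [hT, hIoo] with x h hx
    rw [integral_weightedKernel_mul _ K f hx, ← h]
  obtain ⟨u, -, -, huniq⟩ := hwp 0 MemLp.zero
  have h1 : f =ᵐ[unitMeasure] u := huniq f hfu (by
    change ∀ᵐ x ∂unitMeasure, _
    filter_upwards [hT] with x h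
    rw [Pi.zero_apply, sub_eq_zero]
    exact h)
  have h2 : (0 : ℝ → ℝ) =ᵐ[unitMeasure] u := huniq 0 MemLp.zero
    (Eventually.of_forall fun x => by simp [volterra])
  exact Lp.eq_zero_iff_ae_eq_zero.2
    (jacobiMeasure_absolutelyContinuous.ae_le (h1.trans h2.symm))

lemma eq_zero_of_volterraL_eq_self {lim : Limit} {K : ℝ → ℝ → ℝ} (hK : AdmissibleKernel lim K)
    (hwp : WellPosed lim K) {f : Lp ℝ 2 jacobiMeasure} (hf : volterraL hK f = f) : f = 0 := by
  cases lim
  · exact eq_zero_of_volterraL_toX hK hf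
  · exact eq_zero_of_volterraL_toOneSubX hK hwp hf

/-! ## The coefficient-space operator -/

/-- The Volterra operator in the Jacobi coefficient space. -/
noncomputable def coeffVolterra {lim : Limit} {K : ℝ → ℝ → ℝ} (hK : AdmissibleKernel lim K) :
    CoeffSpace →L[ℝ] CoeffSpace :=
  (jacobiHilbertBasis.repr.toContinuousLinearEquiv : _ →L[ℝ] CoeffSpace) ∘L volterraL hK ∘L
    (jacobiHilbertBasis.repr.symm.toContinuousLinearEquiv : CoeffSpace →L[ℝ] _)

lemma coeffVolterra_apply {lim : Limit} {K : ℝ → ℝ → ℝ} (hK : AdmissibleKernel lim K)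
    (a : CoeffSpace) : coeffVolterra hK a =
      jacobiHilbertBasis.repr (volterraL hK (jacobiHilbertBasis.repr.symm a)) := rfl

lemma coeffVolterra_single {lim : Limit} {K : ℝ → ℝ → ℝ} (hK : AdmissibleKernel lim K) (j : ℕ) :
    coeffVolterra hK (lp.single 2 j (1 : ℝ)) =
      jacobiHilbertBasis.repr (volterraL hK (jacobiLp j)) := by
  rw [coeffVolterra_apply, HilbertBasis.repr_symm_single, coe_jacobiHilbertBasis]

lemma coeffVolterra_single_apply {lim : Limit} {K : ℝ → ℝ → ℝ} (hK : AdmissibleKernel lim K)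
    (i j : ℕ) : coeffVolterra hK (lp.single 2 j (1 : ℝ)) i = methodMatrix lim K i j := by
  rw [coeffVolterra_single, jacobiHilbertBasis_repr_apply, methodMatrix]
  refine jacobiCoeff_congr ?_ i
  filter_upwards [volterraL_ae hK (jacobiLp j), ae_mem_Ioo_jacobiMeasure] with x h hx
  rw [h, methodOperator_eq_volterra lim K _ hx, volterra_congr lim K (jacobiLp_ae j) hx]

lemma summable_norm_coeffVolterra_sq {lim : Limit} {K : ℝ → ℝ → ℝ}
    (hK : AdmissibleKernel lim K) :
    Summable fun j => ‖coeffVolterra hK (lp.single 2 j (1 : ℝ))‖ ^ 2 := by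
  simp_rw [coeffVolterra_single, LinearIsometryEquiv.norm_map]
  exact summable_norm_hilbertSchmidt_sq (memLp_weightedKernel hK) orthonormal_jacobiLp

/-- Fredholm alternative at 1: an eigenvector would be a nonzero fixed point of the Volterra
operator. -/
lemma isUnit_one_sub_coeffVolterra {lim : Limit} {K : ℝ → ℝ → ℝ} (hK : AdmissibleKernel lim K)
    (hwp : WellPosed lim K) : IsUnit (1 - coeffVolterra hK) := by
  have hc := isCompactOperator_of_summable _ (summable_norm_coeffVolterra_sq hK)
  rcases hc.hasEigenvalue_or_mem_resolventSet (one_ne_zero (α := ℝ)) with h | h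
  · obtain ⟨a, ha⟩ := h.exists_hasEigenvector
    have h1 : coeffVolterra hK a = a := by simpa using ha.apply_eq_smul
    have h2 : volterraL hK (jacobiHilbertBasis.repr.symm a) = jacobiHilbertBasis.repr.symm a := by
      rw [LinearIsometryEquiv.eq_symm_apply]
      exact h1
    have h3 := eq_zero_of_volterraL_eq_self hK hwp h2
    exact absurd ((map_eq_zero_iff _ (LinearIsometryEquiv.injective _)).1 h3) ha.2
  · simpa [resolventSet] using h

lemma exists_coeff_solution {lim : Limit} {K : ℝ → ℝ → ℝ} (hK : AdmissibleKernel lim K)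
    (hwp : WellPosed lim K) (b : CoeffSpace) : ∃ a, a - coeffVolterra hK a = b := by
  obtain ⟨U, hU⟩ := isUnit_one_sub_coeffVolterra hK hwp
  refine ⟨(↑U⁻¹ : CoeffSpace →L[ℝ] CoeffSpace) b, ?_⟩
  change (1 - coeffVolterra hK) _ = b
  rw [← hU]
  exact DFunLike.congr_fun U.mul_inv b

end VolterraSpectral

theorem mainTheorem2 (lim : VolterraSpectral.Limit) (K : ℝ → ℝ → ℝ)
    (hK : VolterraSpectral.AdmissibleKernel lim K)
    (hwp : VolterraSpectral.WellPosed lim K) :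
    ∃ V : VolterraSpectral.CoeffSpace →L[ℝ] VolterraSpectral.CoeffSpace,
      -- the coefficient-space operator is the identity minus a compact one, and is invertible
      (∀ i j : ℕ, V (lp.single 2 j (1 : ℝ)) i = VolterraSpectral.methodMatrix lim K i j) ∧
      IsCompactOperator V ∧
      IsUnit (1 - V) ∧
      ∃ (C : ℝ) (N : ℕ),
        -- the linear systems of the method are uniquely solvable from some size on
        (∀ n : ℕ, N ≤ n → IsUnit (VolterraSpectral.sectionMatrix lim K n)) ∧
        ∀ g : ℝ → ℝ, MemLp g 2 VolterraSpectral.jacobiMeasure →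
          ∃ u : ℝ → ℝ, MemLp u 2 VolterraSpectral.jacobiMeasure ∧
            VolterraSpectral.IsSolution lim K u g ∧
            (∀ v : ℝ → ℝ, MemLp v 2 VolterraSpectral.jacobiMeasure →
              VolterraSpectral.IsSolution lim K v g →
              v =ᵐ[VolterraSpectral.jacobiMeasure] u) ∧
            ∃ a b : VolterraSpectral.CoeffSpace,
              (∀ i : ℕ, a i = VolterraSpectral.jacobiCoeff u i) ∧
              (∀ i : ℕ, b i = VolterraSpectral.jacobiCoeff g i) ∧
              a - V a = b ∧
              -- the error of the method behaves like `‖a - 𝒫_n a‖`, which tends to `0`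
              (∀ n : ℕ, N ≤ n →
                ‖a - VolterraSpectral.truncate n a‖ ≤
                    ‖a - VolterraSpectral.methodSolution lim K n b‖ ∧
                ‖a - VolterraSpectral.methodSolution lim K n b‖ ≤
                    C * ‖a - VolterraSpectral.truncate n a‖) ∧
              Tendsto (fun n : ℕ => ‖a - VolterraSpectral.truncate n a‖) atTop (𝓝 0) ∧
              Tendsto (fun n : ℕ => ‖a - VolterraSpectral.methodSolution lim K n b‖)
                atTop (𝓝 0) := by
  refine ⟨VolterraSpectral.coeffVolterra hK, VolterraSpectral.coeffVolterra_single_apply hK,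
    VolterraSpectral.isCompactOperator_of_summable _
      (VolterraSpectral.summable_norm_coeffVolterra_sq hK),
    VolterraSpectral.isUnit_one_sub_coeffVolterra hK hwp, ?_⟩
  obtain ⟨C, N, hunit, hquasi⟩ := VolterraSpectral.exists_finite_section_quasi_optimal
    (VolterraSpectral.coeffVolterra_single_apply hK)
    (VolterraSpectral.summable_norm_coeffVolterra_sq hK)
    (VolterraSpectral.isUnit_one_sub_coeffVolterra hK hwp)
  refine ⟨C, N, hunit, fun g hg => ?_⟩
  set b := VolterraSpectral.jacobiHilbertBasis.repr (hg.toLp g) with hb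
  obtain ⟨a, hab⟩ := VolterraSpectral.exists_coeff_solution hK hwp b
  set f := VolterraSpectral.jacobiHilbertBasis.repr.symm a with hf
  have hfa : VolterraSpectral.jacobiHilbertBasis.repr f = a :=
    LinearIsometryEquiv.apply_symm_apply _ _
  have hfg : f - VolterraSpectral.volterraL hK f = hg.toLp g := by
    apply VolterraSpectral.jacobiHilbertBasis.repr.injective
    rw [map_sub, hfa, ← hb, ← hab, VolterraSpectral.coeffVolterra_apply]
  have hfm := Lp.memLp f
  have hft : hfm.toLp f = f := Lp.toLp_coeFn f hfm
  have htrunc := ((tendsto_const_nhds (x := a)).sub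
    (VolterraSpectral.tendsto_truncate a)).norm
  rw [sub_self, norm_zero] at htrunc
  refine ⟨f, hfm, ?_, fun v hv hvs => ?_, a, b, fun i => ?_, fun i => ?_, hab, fun n hn =>
    ⟨VolterraSpectral.norm_sub_truncate_le_norm_sub_embed a _, hquasi a b hab n hn⟩, htrunc, ?_⟩
  · rw [VolterraSpectral.isSolution_iff hK hfm hg, hft, hfg]
  · rw [VolterraSpectral.isSolution_iff hK hv hg, ← hfg] at hvs
    -- The difference of two solutions is a fixed point, hence zero.
    have h0 : VolterraSpectral.volterraL hK (hv.toLp v - f) = hv.toLp v - f := by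
      rw [map_sub]
      exact (sub_eq_sub_iff_sub_eq_sub.1 hvs).symm
    have h1 := VolterraSpectral.eq_zero_of_volterraL_eq_self hK hwp h0
    rw [sub_eq_zero] at h1
    rw [← h1]
    exact hv.coeFn_toLp.symm
  · rw [← hfa, VolterraSpectral.jacobiHilbertBasis_repr_apply]
  · rw [hb, VolterraSpectral.jacobiHilbertBasis_repr_apply]
    exact VolterraSpectral.jacobiCoeff_congr hg.coeFn_toLp i
  · have hC := htrunc.const_mul C
    rw [mul_zero] at hC
    refine squeeze_zero' (Eventually.of_forall fun n => norm_nonneg _) ?_ hC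
    filter_upwards [eventually_ge_atTop N] with n hn
    exact hquasi a b hab n hn
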